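/- Let $(M,g)$ be a compact smooth Riemannian manifold of dimension $m\ge 3$, possibly with nonempty boundary, with volume measure $dv_g$. For a finite nonnegative Borel measure $\mu$ on $M$ and $k\ge 0$ let $$\lambda_k(\mu)=\inf_{F}\ \sup_{0\ne\phi\in F}\frac{\int_M|d\phi|_g^2\,dv_g}{\int_M\phi^2\,d\mu}\ \in[0,\infty],$$ where $F$ ranges over the $(k+1)$-dimensional linear subspaces of $C^\infty(M)$ and the quotient is $\infty$ whenever $\int_M\phi^2\,d\mu=0$. Let $(\mu_n)_{n\in\mathbb N}$ be a sequence of finite nonnegative Borel measures on $M$ without atoms, i.e. $\mu_n(\{p\})=0$ for every $p\in M$, converging weakly$^*$ to a finite nonnegative Borel measure $\mu$, that is $\int\phi\,d\mu_n\to\int\phi\,d\mu$ for every $\phi\in C(M)$. If, for some fixed $k$, there is a constant $c>0$ with $\lambda_k(\mu_n)\ge c$ for all $n$, then $\mu$ has no atoms: $\mu(\{p\})=0$ for every $p\in M$. -/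

import Mathlib

open MeasureTheory Filter Topology
open scoped Manifold ContDiff ENNReal

namespace MeasureEigenvalue

noncomputable section

variable {m : ℕ} {H : Type*} [TopologicalSpace H]
  (I : ModelWithCorners ℝ (EuclideanSpace ℝ (Fin m)) H)
  {M : Type*} [TopologicalSpace M] [ChartedSpace H M] [IsManifold I ∞ M]

/-- Smooth Riemannian metrics on the `m`-dimensional manifold `M`. The model `I` is arbitrary:
`𝓡 m` gives manifolds without boundary, `𝓡∂ m` gives manifolds with boundary. -/
abbrev Metric (M : Type*) [TopologicalSpace M] [ChartedSpace H M] [IsManifold I ∞ M] : Type _ :=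
  Bundle.ContMDiffRiemannianMetric I ∞ (EuclideanSpace ℝ (Fin m))
    (fun x : M ↦ TangentSpace I x)

/-- The coordinate vector `∂ᵢ` of the chart at `x`, at the point with coordinates `y`. -/
def coordVec (x : M) (y : EuclideanSpace ℝ (Fin m)) (i : Fin m) :
    TangentSpace I ((extChartAt I x).symm y) :=
  mfderivWithin 𝓘(ℝ, EuclideanSpace ℝ (Fin m)) I (extChartAt I x).symm (Set.range I) y
    (EuclideanSpace.single i (1 : ℝ) : EuclideanSpace ℝ (Fin m))

variable {I}

/-- The matrix `g_{ij} = g(∂ᵢ, ∂ⱼ)` of the metric in the chart at `x`, as a function of the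
coordinates `y`. -/
def gramMatrix (g : Metric I M) (x : M) (y : EuclideanSpace ℝ (Fin m)) :
    Matrix (Fin m) (Fin m) ℝ :=
  Matrix.of fun i j ↦ g.inner ((extChartAt I x).symm y) (coordVec I x y i) (coordVec I x y j)

/-- The measure `√(det g_{ij}) dy` of the chart at `x`, transported to `M`; it is carried by the
domain of the chart. -/
def chartVolume [MeasurableSpace M] (g : Metric I M) (x : M) : Measure M :=
  Measure.map (extChartAt I x).symm
    ((volume.restrict (extChartAt I x).target).withDensity
      fun y ↦ ENNReal.ofReal (Real.sqrt (gramMatrix g x y).det))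

/-- The Riemannian volume measure `dv_g`. By the change of variables formula the measures
`chartVolume g x` are the restrictions of one measure to the chart domains, so their supremum in
the lattice of measures is that measure. -/
def volumeMeasure [MeasurableSpace M] (g : Metric I M) : Measure M :=
  ⨆ x : M, chartVolume g x

/-- `|dφ|²_g` at `q`: the square of the norm, dual to `g`, of the covector `dφ_q`. -/
def normSqDifferential (g : Metric I M) (φ : M → ℝ) (q : M) : ℝ≥0∞ :=
  ⨆ (v : TangentSpace I q) (_ : g.inner q v v ≤ 1),
    ENNReal.ofReal ((show ℝ from mfderiv I 𝓘(ℝ, ℝ) φ q v) ^ 2)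

/-- The Dirichlet energy `∫ |dφ|²_g dv_g`. -/
def dirichletEnergy [MeasurableSpace M] (g : Metric I M) (φ : M → ℝ) : ℝ≥0∞ :=
  ∫⁻ q, normSqDifferential g φ q ∂(volumeMeasure g)

/-- `∫ φ² dμ`. -/
def massSq [MeasurableSpace M] (μ : Measure M) (φ : M → ℝ) : ℝ≥0∞ :=
  ∫⁻ q, ENNReal.ofReal (φ q ^ 2) ∂μ

open scoped Classical in
/-- The Rayleigh quotient `∫ |dφ|²_g dv_g / ∫ φ² dμ`, with the value `∞` if `φ = 0` almost
everywhere for `μ`. -/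
def rayleigh [MeasurableSpace M] (g : Metric I M) (μ : Measure M) (φ : M → ℝ) : ℝ≥0∞ :=
  if massSq μ φ = 0 then ⊤ else dirichletEnergy g φ / massSq μ φ

/-- The variational eigenvalue `λ_k(μ, g) ∈ [0, ∞]`: the infimum over the `(k+1)`-dimensional
subspaces `F` of `C^∞(M)` of the supremum of the Rayleigh quotient over nonzero `φ ∈ F`. -/
def eigenvalue [MeasurableSpace M] (g : Metric I M) (k : ℕ) (μ : Measure M) : ℝ≥0∞ :=
  ⨅ (F : Submodule ℝ C^∞⟮I, M; 𝓘(ℝ, ℝ), ℝ⟯) (_ : Module.finrank ℝ F = k + 1),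
    ⨆ (φ : C^∞⟮I, M; 𝓘(ℝ, ℝ), ℝ⟯) (_ : φ ∈ F) (_ : φ ≠ 0), rayleigh g μ φ

end

end MeasureEigenvalue

/-!
The theorem holds because, in dimension `m ≥ 3`, a cut-off function at scale `r` has Dirichlet
energy of order `r ^ (m - 2)`, which tends to `0` with `r`.

Suppose that `μ` has an atom at `p`. In the chart at `p`, the mass of `μs n` in a coordinate ball
of radius `R` is bounded below for large `n`, uniformly in `R`
(`eventually_lt_measure_of_tendsto`). As `μs n` has no atoms, this mass can be split into `k + 1`
separated parts at scales at most `R` (`exists_separated_functions`). The splitting is greedy: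
`exists_concentrated_ball` gives a ball `B(x, r)` of mass at least `a` with `B(x, 4r)` of mass at
most `A a`, where `A` depends only on the dimension; one test function is a cut-off of `B(x, r)`
supported in `B(x, 2r)`, and the construction continues with the measure outside `B(x, 4r)`, the
later functions being multiplied by a function that vanishes on `B(x, 2r)`. Every test function
has mass at least `a` and energy `O(R ^ (m - 2))`, whatever the scale at which `μs n` concentrates.

Lifted to `M`, the functions keep these bounds. In the chart at `p` the metric is comparable to the
Euclidean one, and the change of variables formula (`chartVolume_apply_le`) bounds the supremum over
all charts that defines the Riemannian volume by the volume of that chart alone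
(`volumeMeasure_restrict_source_le`, `exists_dirichletEnergy_chartLift_le`). The span of the lifts
shows that `λ_k(μs n) = O(R ^ (m - 2))` (`exists_eigenvalue_le_of_concentrated`), and `R → 0`
contradicts the lower bound `c`.
-/

namespace MeasureEigenvalue

/-! ### Test functions separating a non-atomic measure on a Euclidean space -/

section Euclidean

variable {E : Type*} [NormedAddCommGroup E] [NormedSpace ℝ E] [FiniteDimensional ℝ E]
  [MeasurableSpace E] [BorelSpace E]

/-- A finite measure without atoms has a ball of mass at least `a` whose fourfold enlargement has
mass at most a dimensional constant times `a`. It suffices to halve the radius as long as some ball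
of mass at least `a` survives; the enlargement of the last such ball is covered by a bounded number
of balls of half its radius. -/
theorem exists_concentrated_ball :
    ∃ A : ℕ, ∀ (ν : Measure E) [IsFiniteMeasure ν] (y₀ : E) (R : ℝ) (a : ℝ≥0∞), 0 < R →
      (∀ y, ν {y} = 0) → ν (Metric.ball y₀ R)ᶜ = 0 → 0 < a → a ≤ ν Set.univ →
      ∃ (x : E) (r : ℝ), 0 < r ∧ r ≤ R ∧ dist x y₀ ≤ 2 * R ∧ a ≤ ν (Metric.ball x r) ∧
        ν (Metric.ball x (4 * r)) ≤ A * a := by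
  obtain ⟨t, -, ht⟩ := (isCompact_closedBall (0 : E) 4).elim_nhds_subcover
    (fun c ↦ Metric.ball c (1 / 2)) fun c _ ↦ Metric.ball_mem_nhds c (by norm_num)
  refine ⟨t.card, fun ν _ y₀ R a hR hatom hsupp ha hmass ↦ ?_⟩
  have hmeet : ∀ (x : E) (r : ℝ), r ≤ R → a ≤ ν (Metric.ball x r) → dist x y₀ ≤ 2 * R := by
    intro x r hr hx
    by_contra! hfar
    have : Metric.ball x r ⊆ (Metric.ball y₀ R)ᶜ := by
      intro y hy hy'
      rw [Metric.mem_ball] at hy hy'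
      have := dist_triangle_left x y₀ y
      linarith
    exact ha.not_ge (hx.trans ((measure_mono this).trans hsupp.le))
  -- Absence of atoms forces the balls of mass at least `a` to have radii bounded below.
  have hsmall : ∃ j : ℕ, ∀ x, ν (Metric.ball x (R / 2 ^ j)) < a := by
    by_contra! hbig
    choose x hx using hbig
    have hle : ∀ j : ℕ, R / 2 ^ j ≤ R := fun j ↦ div_le_self hR.le (one_le_pow₀ (by norm_num))
    obtain ⟨z, -, φ, hφ, hz⟩ := (isCompact_closedBall y₀ (2 * R)).tendsto_subseq
      (x := x) fun j ↦ hmeet _ _ (hle j) (hx j)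
    obtain ⟨U, hzU, hU, hUa⟩ := Set.exists_isOpen_lt_of_lt {z} a ((hatom z).trans_lt ha)
    obtain ⟨ε, hε, hεU⟩ := Metric.isOpen_iff.1 hU z (hzU rfl)
    have hrad : Tendsto (fun j : ℕ ↦ R / 2 ^ φ j) atTop (𝓝 0) := by
      have h := (tendsto_pow_atTop_nhds_zero_of_lt_one (r := (1 / 2 : ℝ)) (by norm_num)
        (by norm_num)).const_mul R |>.comp hφ.tendsto_atTop
      rw [mul_zero] at h
      refine h.congr fun j ↦ ?_
      simp [div_eq_mul_inv]
    have hdist := tendsto_iff_dist_tendsto_zero.1 hz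
    obtain ⟨j, hj₁, hj₂⟩ := ((hrad.eventually_lt_const (half_pos hε)).and
      (hdist.eventually_lt_const (half_pos hε))).exists
    have : Metric.ball (x (φ j)) (R / 2 ^ φ j) ⊆ U := by
      refine (Metric.ball_subset_ball' ?_).trans hεU
      simp only [Function.comp_apply] at hj₂
      linarith
    exact ((hx (φ j)).trans (measure_mono this)).not_gt hUa
  classical
  have hspec := Nat.find_spec hsmall
  obtain hj | ⟨j, hj⟩ : Nat.find hsmall = 0 ∨ ∃ j, Nat.find hsmall = j + 1 := by
    cases Nat.find hsmall <;> simp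
  · exfalso
    rw [hj] at hspec
    have h := hspec y₀
    rw [pow_zero, div_one] at h
    have h' := measure_union_le (μ := ν) (Metric.ball y₀ R) (Metric.ball y₀ R)ᶜ
    rw [Set.union_compl_self, hsupp, add_zero] at h'
    exact (hmass.trans h').not_gt h
  · have hmin := Nat.find_min hsmall (m := j) (by omega)
    push Not at hmin
    obtain ⟨x, hx⟩ := hmin
    rw [hj] at hspec
    have hr : 0 < R / 2 ^ j := by positivity
    have hrR : R / 2 ^ j ≤ R := div_le_self hR.le (one_le_pow₀ (by norm_num))
    refine ⟨x, R / 2 ^ j, hr, hrR, hmeet _ _ hrR hx, hx, ?_⟩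
    set r := R / 2 ^ j with hrdef
    have hcover : Metric.ball x (4 * r) ⊆ ⋃ c ∈ t, Metric.ball (x + r • c) (R / 2 ^ (j + 1)) := by
      intro y hy
      have hy' : r⁻¹ • (y - x) ∈ Metric.closedBall (0 : E) 4 := by
        rw [mem_closedBall_zero_iff, norm_smul, norm_inv, Real.norm_of_nonneg hr.le,
          inv_mul_le_iff₀ hr, ← dist_eq_norm, mul_comm]
        exact (Metric.mem_ball.1 hy).le
      obtain ⟨c, hc, hyc⟩ := Set.mem_iUnion₂.1 (ht hy')
      refine Set.mem_iUnion₂.2 ⟨c, hc, ?_⟩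
      rw [Metric.mem_ball, dist_eq_norm] at hyc ⊢
      have : y - (x + r • c) = r • (r⁻¹ • (y - x) - c) := by
        rw [smul_sub, smul_inv_smul₀ hr.ne']; abel
      rw [this, norm_smul, Real.norm_of_nonneg hr.le]
      calc r * _ < r * (1 / 2) := by gcongr
        _ = R / 2 ^ (j + 1) := by rw [hrdef, pow_succ]; ring
    calc ν (Metric.ball x (4 * r)) ≤ ∑ c ∈ t, ν (Metric.ball (x + r • c) (R / 2 ^ (j + 1))) :=
          (measure_mono hcover).trans (measure_biUnion_finset_le _ _)
      _ ≤ ∑ _c ∈ t, a := Finset.sum_le_sum fun c _ ↦ (hspec _).le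
      _ = t.card * a := by rw [Finset.sum_const, nsmul_eq_mul]

/-- Cut-off functions at all scales, obtained by rescaling a single bump function. Halving the scale
doubles the gradient, so the energy scales like `r ^ (d - 2)`. -/
theorem exists_cutoff (vol : Measure E) [vol.IsAddHaarMeasure] (hd : 2 ≤ Module.finrank ℝ E) :
    ∃ K : ℝ≥0∞, K ≠ ⊤ ∧ ∀ (x : E) (r : ℝ), 0 < r → ∃ η : E → ℝ, ContDiff ℝ ∞ η ∧
      (∀ y, η y ∈ Set.Icc (0 : ℝ) 1) ∧ (∀ y ∈ Metric.ball x r, η y = 1) ∧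
      (∀ y ∉ Metric.ball x (2 * r), η y = 0) ∧
      ∫⁻ y, ‖fderiv ℝ η y‖ₑ ^ 2 ∂vol ≤ K * ENNReal.ofReal (r ^ (Module.finrank ℝ E - 2)) := by
  let ψ : ContDiffBump (0 : E) := ⟨1, 2, one_pos, one_lt_two⟩
  have hψ : ContDiff ℝ ∞ ψ := ψ.contDiff
  obtain ⟨C, hC⟩ := (hψ.continuous_fderiv (by simp)).bounded_above_of_compact_support
    (ψ.hasCompactSupport.fderiv (𝕜 := ℝ))
  have hC0 : 0 ≤ C := (norm_nonneg _).trans (hC 0)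
  set d := Module.finrank ℝ E
  refine ⟨ENNReal.ofReal (C ^ 2 * 2 ^ d) * vol (Metric.ball 0 1),
    ENNReal.mul_ne_top ENNReal.ofReal_ne_top measure_ball_lt_top.ne, fun x r hr ↦ ?_⟩
  have hmem : ∀ (s : ℝ) (y : E), r⁻¹ • (y - x) ∈ Metric.ball 0 s ↔ y ∈ Metric.ball x (s * r) := by
    intro s y
    rw [mem_ball_zero_iff, norm_smul, norm_inv, Real.norm_of_nonneg hr.le, Metric.mem_ball,
      dist_eq_norm, inv_mul_lt_iff₀ hr, mul_comm]
  have hzero : ∀ y ∉ Metric.ball x (2 * r), ψ (r⁻¹ • (y - x)) = 0 := by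
    intro y hy
    rw [← hmem] at hy
    rwa [← Function.notMem_support, ψ.support_eq]
  have hder : ∀ y, fderiv ℝ (fun y ↦ ψ (r⁻¹ • (y - x))) y =
      r⁻¹ • fderiv ℝ ψ (r⁻¹ • (y - x)) := by
    intro y
    have h₁ : HasFDerivAt (fun y : E ↦ r⁻¹ • (y - x)) (r⁻¹ • ContinuousLinearMap.id ℝ E) y :=
      ((hasFDerivAt_id y).sub_const x).const_smul r⁻¹
    have h₂ := ((hψ.differentiable (by simp)) (r⁻¹ • (y - x))).hasFDerivAt.comp y h₁
    refine h₂.fderiv.trans ?_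
    ext v; simp
  refine ⟨fun y ↦ ψ (r⁻¹ • (y - x)), hψ.comp (by fun_prop), fun y ↦ ⟨ψ.nonneg, ψ.le_one⟩,
    fun y hy ↦ ?_, hzero, ?_⟩
  · apply ψ.one_of_mem_closedBall
    apply Metric.ball_subset_closedBall
    rw [show ψ.rIn = 1 from rfl, hmem, one_mul]; exact hy
  · have hbound : ∀ y, ‖fderiv ℝ (fun y ↦ ψ (r⁻¹ • (y - x))) y‖ₑ ^ 2 ≤
        (Metric.closedBall x (2 * r)).indicator (fun _ ↦ ENNReal.ofReal (C ^ 2 / r ^ 2)) y := by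
      intro y
      by_cases hy : y ∈ Metric.closedBall x (2 * r)
      · rw [Set.indicator_of_mem hy, hder, ← ofReal_norm,
          ← ENNReal.ofReal_pow (norm_nonneg _), norm_smul, norm_inv, Real.norm_of_nonneg hr.le,
          mul_pow, inv_pow, mul_comm, ← div_eq_mul_inv]
        gcongr
        exact hC _
      · rw [Set.indicator_of_notMem hy]
        have : (fun y ↦ ψ (r⁻¹ • (y - x))) =ᶠ[𝓝 y] fun _ ↦ 0 := by
          filter_upwards [Metric.isClosed_closedBall.isOpen_compl.mem_nhds hy] with z hz
          exact hzero z fun h ↦ hz (Metric.ball_subset_closedBall h)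
        have h0 : fderiv ℝ (fun y ↦ ψ (r⁻¹ • (y - x))) y = 0 :=
          this.fderiv_eq.trans (fderiv_const_apply 0)
        rw [h0, ← ofReal_norm, norm_zero]
        simp
    calc _ ≤ ∫⁻ y, (Metric.closedBall x (2 * r)).indicator
              (fun _ ↦ ENNReal.ofReal (C ^ 2 / r ^ 2)) y ∂vol := lintegral_mono hbound
      _ = ENNReal.ofReal (C ^ 2 / r ^ 2) *
            (ENNReal.ofReal ((2 * r) ^ d) * vol (Metric.ball 0 1)) := by
          rw [lintegral_indicator Metric.isClosed_closedBall.measurableSet, setLIntegral_const,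
            Measure.addHaar_closedBall vol x (by positivity)]
      _ = ENNReal.ofReal (C ^ 2 / r ^ 2 * (2 * r) ^ d) * vol (Metric.ball 0 1) := by
          rw [← mul_assoc, ENNReal.ofReal_mul (by positivity)]
      _ = _ := by
          rw [mul_right_comm, ← ENNReal.ofReal_mul (by positivity)]
          congr 2
          obtain ⟨e, he⟩ := Nat.exists_eq_add_of_le hd
          rw [he, Nat.add_sub_cancel_left, mul_pow, pow_add r]
          field_simp

/-- A finite measure without atoms carried by a ball of radius `R` admits `N` test functions with
disjoint supports, mass at least a fixed fraction of the total mass, and energy `O(R ^ (d - 2))`.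
The constants depend only on `N` and the space, not on the scale at which the measure lives. -/
theorem exists_separated_functions (vol : Measure E) [vol.IsAddHaarMeasure]
    (hd : 2 ≤ Module.finrank ℝ E) (N : ℕ) :
    ∃ (A : ℕ) (K : ℝ≥0∞), K ≠ ⊤ ∧ ∀ (ν : Measure E) [IsFiniteMeasure ν] (y₀ : E) (R : ℝ)
      (a : ℝ≥0∞), 0 < R → (∀ y, ν {y} = 0) → ν (Metric.ball y₀ R)ᶜ = 0 → 0 < a →
      A * a ≤ ν Set.univ →
      ∃ f : Fin N → E → ℝ, (∀ j, ContDiff ℝ ∞ (f j)) ∧ (∀ j y, f j y ∈ Set.Icc (0 : ℝ) 1) ∧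
        (∀ j, ∀ y ∉ Metric.closedBall y₀ (4 * R), f j y = 0) ∧
        (∀ i j, i ≠ j → ∀ y, f i y * f j y = 0) ∧
        (∀ j, a ≤ ∫⁻ y, ENNReal.ofReal (f j y ^ 2) ∂ν) ∧
        ∀ j, ∫⁻ y, ‖fderiv ℝ (f j) y‖ₑ ^ 2 ∂vol ≤
          K * ENNReal.ofReal (R ^ (Module.finrank ℝ E - 2)) := by
  obtain ⟨A₀, hA₀⟩ := exists_concentrated_ball (E := E)
  obtain ⟨K₀, hK₀, hcut⟩ := exists_cutoff vol hd
  set d := Module.finrank ℝ E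
  induction N with
  | zero =>
    exact ⟨0, 0, by simp, fun ν _ y₀ R a _ _ _ _ _ ↦ ⟨fun _ _ ↦ 0, fun j ↦ j.elim0,
      fun j ↦ j.elim0, fun j ↦ j.elim0, fun j ↦ j.elim0, fun j ↦ j.elim0, fun j ↦ j.elim0⟩⟩
  | succ N ih =>
    obtain ⟨A, K, hK, ih⟩ := ih
    refine ⟨A₀ + A + 1, K₀ + 2 * (K + K₀ * ENNReal.ofReal (2 ^ (d - 2))), ?_,
      fun ν _ y₀ R a hR hatom hsupp ha hmass ↦ ?_⟩
    · finiteness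
    push_cast at hmass
    have ha1 : a ≤ ν Set.univ := by
      refine le_trans ?_ hmass
      rw [add_mul, one_mul]
      exact le_add_self
    have hatop : a ≠ ⊤ := ne_top_of_le_ne_top (measure_ne_top ν _) ha1
    obtain ⟨x, r, hr, hrR, hxy, hmx, hmx4⟩ := hA₀ ν y₀ R a hR hatom hsupp ha ha1
    obtain ⟨η, hη, hη01, hη1, hη0, hηe⟩ := hcut x r hr
    obtain ⟨ζ, hζ, hζ01, hζ1, hζ0, hζe⟩ := hcut x (2 * r) (by positivity)
    rw [← mul_assoc, show (2 * 2 : ℝ) = 4 by norm_num] at hζ0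
    have hB : MeasurableSet (Metric.ball x (4 * r))ᶜ := Metric.isOpen_ball.measurableSet.compl
    -- The remaining functions are those of the measure outside `ball x (4 * r)`, where `ζ = 0`;
    -- the factor `1 - ζ` makes them vanish on `ball x (2 * r)`, which contains the support of `η`.
    obtain ⟨f, hf, hf01, hf0, hfd, hfm, hfe⟩ := ih (ν.restrict (Metric.ball x (4 * r))ᶜ) y₀ R a hR
      (fun y ↦ le_antisymm ((Measure.restrict_apply_le _ _).trans (hatom y).le) bot_le)
      (le_antisymm ((Measure.restrict_apply_le _ _).trans hsupp.le) bot_le) ha (by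
        rw [Measure.restrict_apply_univ]
        have h := measure_add_measure_compl (μ := ν)
          (Metric.isOpen_ball (x := x) (ε := 4 * r)).measurableSet
        have h1 : (A₀ * a : ℝ≥0∞) + A * a ≤ A₀ * a + ν (Metric.ball x (4 * r))ᶜ := by
          calc (A₀ * a : ℝ≥0∞) + A * a ≤ (A₀ + A + 1) * a := by
                rw [add_mul, add_mul]; exact le_self_add
            _ ≤ _ := hmass
            _ = _ := h.symm
            _ ≤ _ := by gcongr
        exact (ENNReal.add_le_add_iff_left (by finiteness)).1 h1)
    refine ⟨Fin.cons η fun j y ↦ f j y * (1 - ζ y), ?_, ?_, ?_, ?_, ?_, ?_⟩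
    · refine Fin.cases hη fun j ↦ ?_
      simpa using (hf j).mul (contDiff_const.sub hζ)
    · refine Fin.cases hη01 fun j y ↦ ?_
      have h1 := hf01 j y
      have h2 := hζ01 y
      simp only [Fin.cons_succ, Set.mem_Icc] at *
      exact ⟨mul_nonneg h1.1 (by linarith), mul_le_one₀ h1.2 (by linarith) (by linarith)⟩
    · refine Fin.cases (fun y hy ↦ hη0 y fun h ↦ hy ?_) fun j y hy ↦ ?_
      · rw [Metric.mem_ball] at h
        rw [Metric.mem_closedBall]
        linarith [dist_triangle y x y₀]
      · simp [hf0 j y hy]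
    · have key : ∀ (j : Fin N) (y : E), η y * (f j y * (1 - ζ y)) = 0 := by
        intro j y
        by_cases hy : y ∈ Metric.ball x (2 * r)
        · simp [hζ1 y hy]
        · simp [hη0 y hy]
      refine Fin.cases (fun j ↦ ?_) fun i j ↦ ?_
      · refine Fin.cases (fun h ↦ (h rfl).elim) (fun j _ y ↦ ?_) j
        simpa using key j y
      · refine Fin.cases (fun _ y ↦ ?_) (fun j hij y ↦ ?_) j
        · simpa [mul_comm] using key i y
        · have := hfd i j (fun h ↦ hij (by rw [h])) y
          simp only [Fin.cons_succ]
          linear_combination (1 - ζ y) ^ 2 * this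
    · refine Fin.cases ?_ fun j ↦ ?_
      · calc a ≤ ν (Metric.ball x r) := hmx
          _ = ∫⁻ y in Metric.ball x r, 1 ∂ν := by simp
          _ ≤ ∫⁻ y in Metric.ball x r, ENNReal.ofReal (η y ^ 2) ∂ν := by
              refine setLIntegral_mono' Metric.isOpen_ball.measurableSet fun y hy ↦ ?_
              simp [hη1 y hy]
          _ ≤ _ := setLIntegral_le_lintegral _ _
      · refine (hfm j).trans ((setLIntegral_mono' hB fun y hy ↦ ?_).trans
          (setLIntegral_le_lintegral (Metric.ball x (4 * r))ᶜ _))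
        simp [hζ0 y hy]
    · refine Fin.cases ?_ fun j ↦ ?_
      · calc _ ≤ K₀ * ENNReal.ofReal (r ^ (d - 2)) := hηe
          _ ≤ _ := by gcongr; exact le_self_add
      · have hpt : ∀ y, ‖fderiv ℝ (fun y ↦ f j y * (1 - ζ y)) y‖ₑ ^ 2 ≤
            2 * (‖fderiv ℝ (f j) y‖ₑ ^ 2 + ‖fderiv ℝ ζ y‖ₑ ^ 2) := by
          intro y
          have h1 := ((hf j).differentiable (by simp) y).hasFDerivAt
          have h2 := (hζ.differentiable (by simp) y).hasFDerivAt.const_sub 1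
          have h3 : fderiv ℝ (fun y ↦ f j y * (1 - ζ y)) y =
              f j y • -fderiv ℝ ζ y + (1 - ζ y) • fderiv ℝ (f j) y := (h1.mul h2).fderiv
          rw [h3]
          have hn : ‖f j y • -fderiv ℝ ζ y + (1 - ζ y) • fderiv ℝ (f j) y‖ ≤
              ‖fderiv ℝ (f j) y‖ + ‖fderiv ℝ ζ y‖ := by
            have hf' := hf01 j y
            have hz' := hζ01 y
            refine (norm_add_le _ _).trans ?_
            rw [norm_smul, norm_smul, norm_neg, Real.norm_of_nonneg hf'.1,
              Real.norm_of_nonneg (by linarith [hz'.2]), add_comm]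
            exact add_le_add (mul_le_of_le_one_left (norm_nonneg _) (by linarith [hz'.1]))
              (mul_le_of_le_one_left (norm_nonneg _) hf'.2)
          simp only [← ofReal_norm]
          rw [← ENNReal.ofReal_pow (norm_nonneg _), ← ENNReal.ofReal_pow (norm_nonneg _),
            ← ENNReal.ofReal_pow (norm_nonneg _), ← ENNReal.ofReal_add (by positivity)
            (by positivity), ← ENNReal.ofReal_ofNat 2, ← ENNReal.ofReal_mul (by positivity)]
          exact ENNReal.ofReal_le_ofReal ((pow_le_pow_left₀ (norm_nonneg _) hn 2).trans add_sq_le)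
        have hcont : Continuous fun y ↦ ‖fderiv ℝ (f j) y‖ₑ ^ 2 :=
          (ENNReal.continuous_pow 2).comp ((hf j).continuous_fderiv (by simp)).enorm
        calc _ ≤ ∫⁻ y, 2 * (‖fderiv ℝ (f j) y‖ₑ ^ 2 + ‖fderiv ℝ ζ y‖ₑ ^ 2) ∂vol :=
              lintegral_mono hpt
          _ = 2 * (∫⁻ y, ‖fderiv ℝ (f j) y‖ₑ ^ 2 ∂vol + ∫⁻ y, ‖fderiv ℝ ζ y‖ₑ ^ 2 ∂vol) := by
              rw [lintegral_const_mul' _ _ (by simp), lintegral_add_left hcont.measurable]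
          _ ≤ 2 * (K * ENNReal.ofReal (R ^ (d - 2)) +
                K₀ * (ENNReal.ofReal (2 ^ (d - 2)) * ENNReal.ofReal (R ^ (d - 2)))) := by
              gcongr
              · exact hfe j
              · refine hζe.trans ?_
                rw [mul_pow, ENNReal.ofReal_mul (by positivity)]
                gcongr
          _ = 2 * (K + K₀ * ENNReal.ofReal (2 ^ (d - 2))) * ENNReal.ofReal (R ^ (d - 2)) := by ring
          _ ≤ _ := by gcongr; exact le_add_self

end Euclidean

/-! ### Local bounds for a Riemannian metric in a chart -/

section MetricBounds

open Bundle

variable {E : Type*} [NormedAddCommGroup E] [NormedSpace ℝ E] {H : Type*} [TopologicalSpace H]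
  {I : ModelWithCorners ℝ E H} {M : Type*} [TopologicalSpace M] [ChartedSpace H M]
  [IsManifold I ∞ M]

/-- Near `p`, the derivative of the chart at `p` is bounded on the unit balls of the metric. -/
theorem exists_eventually_norm_mfderiv_extChartAt_le
    (g : Bundle.ContMDiffRiemannianMetric I ∞ E (fun x : M ↦ TangentSpace I x)) (p : M) :
    ∃ C : ℝ, 0 < C ∧ ∀ᶠ q in 𝓝 p, ∀ v : TangentSpace I q, g.inner q v v ≤ 1 →
      ‖(show E from mfderiv I 𝓘(ℝ, E) (extChartAt I p) q v)‖ ≤ C := by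
  let _ : Bundle.RiemannianBundle (fun x : M ↦ TangentSpace I x) := ⟨g.toRiemannianMetric⟩
  have : IsManifold I 1 M := .of_le (n := ∞) (by simp)
  have : IsContinuousRiemannianBundle E (fun x : M ↦ TangentSpace I x) :=
    ⟨⟨g.inner, g.contMDiff.continuous, fun _ _ _ ↦ rfl⟩⟩
  obtain ⟨C, hC, h⟩ := eventually_norm_mfderiv_extChartAt_lt I p
  refine ⟨C, hC, h.mono fun q hq v hv ↦ ?_⟩
  have hv1 : ‖v‖ ≤ 1 := by
    rw [← sq_le_one_iff₀ (norm_nonneg v), ← real_inner_self_eq_norm_sq]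
    exact hv
  let T : TangentSpace I q →L[ℝ] E := mfderiv I 𝓘(ℝ, E) (extChartAt I p) q
  exact (T.le_opNorm v).trans
    ((mul_le_of_le_one_right (norm_nonneg _) hv1).trans hq.le)

theorem exists_eventually_abs_inner_mfderivWithin_symm_le
    (g : Bundle.ContMDiffRiemannianMetric I ∞ E (fun x : M ↦ TangentSpace I x)) (p : M) :
    ∃ C : ℝ, 0 < C ∧ ∀ᶠ y in 𝓝[Set.range I] (extChartAt I p p), ∀ u v : E, ‖u‖ ≤ 1 → ‖v‖ ≤ 1 →
      |g.inner ((extChartAt I p).symm y)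
        (mfderivWithin 𝓘(ℝ, E) I (extChartAt I p).symm (Set.range I) y u)
        (mfderivWithin 𝓘(ℝ, E) I (extChartAt I p).symm (Set.range I) y v)| ≤ C := by
  let _ : Bundle.RiemannianBundle (fun x : M ↦ TangentSpace I x) := ⟨g.toRiemannianMetric⟩
  have : IsManifold I 1 M := .of_le (n := ∞) (by simp)
  have : IsContinuousRiemannianBundle E (fun x : M ↦ TangentSpace I x) :=
    ⟨⟨g.inner, g.contMDiff.continuous, fun _ _ _ ↦ rfl⟩⟩
  obtain ⟨C, hC, h⟩ := eventually_norm_mfderivWithin_symm_extChartAt_lt I p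
  refine ⟨C * C, by positivity, h.mono fun y hy u v hu hv ↦ ?_⟩
  let T : E →L[ℝ] TangentSpace I ((extChartAt I p).symm y) :=
    mfderivWithin 𝓘(ℝ, E) I (extChartAt I p).symm (Set.range I) y
  have hcoord : ∀ w : E, ‖w‖ ≤ 1 → ‖T w‖ ≤ C := fun w hw ↦
    (T.le_opNorm w).trans
      ((mul_le_of_le_one_right (norm_nonneg _) hw).trans hy.le)
  exact (abs_real_inner_le_norm _ _).trans
    (mul_le_mul (hcoord u hu) (hcoord v hv) (norm_nonneg _) hC.le)

end MetricBounds

/-! ### The Gram matrix under a change of chart -/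

section Charts

variable {m : ℕ} {H : Type*} [TopologicalSpace H]
  {I : ModelWithCorners ℝ (EuclideanSpace ℝ (Fin m)) H}
  {M : Type*} [TopologicalSpace M] [ChartedSpace H M] [IsManifold I ∞ M]

theorem exists_eventually_sqrt_det_gramMatrix_le (g : Metric I M) (p : M) :
    ∃ C : ℝ, ∀ᶠ y in 𝓝[Set.range I] (extChartAt I p p),
      Real.sqrt (gramMatrix g p y).det ≤ C := by
  obtain ⟨C, -, h⟩ := exists_eventually_abs_inner_mfderivWithin_symm_le g p
  refine ⟨Real.sqrt ((Fintype.card (Fin m)).factorial • C ^ Fintype.card (Fin m)),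
    h.mono fun y hy ↦ Real.sqrt_le_sqrt ((le_abs_self _).trans ?_)⟩
  exact Matrix.det_le (abv := AbsoluteValue.abs) fun i j ↦ hy _ _ (by simp) (by simp)

theorem mfderivWithin_extChartAt_symm_eq_comp (x p : M) {y : EuclideanSpace ℝ (Fin m)}
    (hy : y ∈ (extChartAt I x).target) (hyp : (extChartAt I x).symm y ∈ (extChartAt I p).source)
    (v : EuclideanSpace ℝ (Fin m)) :
    (show EuclideanSpace ℝ (Fin m) from mfderivWithin 𝓘(ℝ, EuclideanSpace ℝ (Fin m)) I
      (extChartAt I x).symm (Set.range I) y v) =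
    mfderivWithin 𝓘(ℝ, EuclideanSpace ℝ (Fin m)) I (extChartAt I p).symm (Set.range I)
      ((extChartAt I p ∘ (extChartAt I x).symm) y)
      (fderivWithin ℝ (extChartAt I p ∘ (extChartAt I x).symm) (Set.range I) y v) := by
  have hyr := extChartAt_target_subset_range x hy
  have hU : UniqueMDiffWithinAt 𝓘(ℝ, EuclideanSpace ℝ (Fin m)) (Set.range I) y :=
    (I.uniqueDiffOn y hyr).uniqueMDiffWithinAt
  have hτ : DifferentiableWithinAt ℝ (extChartAt I p ∘ (extChartAt I x).symm) (Set.range I) y :=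
    (contDiffWithinAt_ext_coord_change (n := ∞) p x ⟨hy, hyp⟩).differentiableWithinAt (by simp)
  have hτy : (extChartAt I p ∘ (extChartAt I x).symm) y ∈ (extChartAt I p).target :=
    (extChartAt I p).map_source hyp
  have hmaps : Set.range I ⊆
      (extChartAt I p ∘ (extChartAt I x).symm) ⁻¹' (Set.range I) := by
    rintro z -
    simp [extChartAt]
  have hcomp := mfderivWithin_comp (I := 𝓘(ℝ, EuclideanSpace ℝ (Fin m)))
    (I' := 𝓘(ℝ, EuclideanSpace ℝ (Fin m))) (I'' := I) y
    (g := (extChartAt I p).symm) (f := extChartAt I p ∘ (extChartAt I x).symm)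
    (mdifferentiableWithinAt_extChartAt_symm hτy) hτ.mdifferentiableWithinAt hmaps hU
  have hev : (extChartAt I x).symm =ᶠ[𝓝[Set.range I] y]
      (extChartAt I p).symm ∘ (extChartAt I p ∘ (extChartAt I x).symm) := by
    have h1 : ∀ᶠ z in 𝓝[Set.range I] y, (extChartAt I x).symm z ∈ (extChartAt I p).source :=
      (mdifferentiableWithinAt_extChartAt_symm hy).continuousWithinAt.preimage_mem_nhdsWithin
        ((isOpen_extChartAt_source p).mem_nhds hyp)
    filter_upwards [h1] with z hz
    exact ((extChartAt I p).left_inv hz).symm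
  have hcongr := hev.mfderivWithin_eq (I := 𝓘(ℝ, EuclideanSpace ℝ (Fin m))) (I' := I)
    ((extChartAt I p).left_inv hyp).symm
  rw [mfderivWithin_eq_fderivWithin] at hcomp
  exact congrArg (fun L : EuclideanSpace ℝ (Fin m) →L[ℝ] EuclideanSpace ℝ (Fin m) ↦ L v)
    (hcongr.trans hcomp)

/-- The Gram matrix of the vectors `∑ₖ Pₖᵢ bₖ` is `Pᵀ G P`, where `G` is that of the `bₖ`. -/
theorem bilin_sum_smul_eq_transpose_mul_mul {E : Type*} [NormedAddCommGroup E] [NormedSpace ℝ E]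
    (B : E →L[ℝ] E →L[ℝ] ℝ) (b : Fin m → E) (P : Matrix (Fin m) (Fin m) ℝ) (i j : Fin m) :
    B (∑ k, P k i • b k) (∑ l, P l j • b l) =
      (P.transpose * Matrix.of (fun k l ↦ B (b k) (b l)) * P) i j := by
  simp only [Matrix.mul_apply, Matrix.transpose_apply, Matrix.of_apply, Finset.sum_mul]
  rw [map_sum]
  refine Finset.sum_congr rfl fun l _ ↦ ?_
  rw [map_smul, map_sum, sum_apply, smul_eq_mul, Finset.mul_sum]
  refine Finset.sum_congr rfl fun k _ ↦ ?_
  rw [map_smul, smul_apply, smul_eq_mul]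
  ring

theorem gramMatrix_eq_of_coord_change (g : Metric I M) (x p : M) {y : EuclideanSpace ℝ (Fin m)}
    (hy : y ∈ (extChartAt I x).target)
    (hyp : (extChartAt I x).symm y ∈ (extChartAt I p).source) :
    gramMatrix g x y =
      (LinearMap.toMatrix (EuclideanSpace.basisFun (Fin m) ℝ).toBasis
        (EuclideanSpace.basisFun (Fin m) ℝ).toBasis
        (fderivWithin ℝ (extChartAt I p ∘ (extChartAt I x).symm)
          (Set.range I) y).toLinearMap).transpose *
      gramMatrix g p ((extChartAt I p ∘ (extChartAt I x).symm) y) *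
      LinearMap.toMatrix (EuclideanSpace.basisFun (Fin m) ℝ).toBasis
        (EuclideanSpace.basisFun (Fin m) ℝ).toBasis
        (fderivWithin ℝ (extChartAt I p ∘ (extChartAt I x).symm) (Set.range I) y).toLinearMap := by
  set τ := extChartAt I p ∘ (extChartAt I x).symm with hτ
  set D := fderivWithin ℝ τ (Set.range I) y with hD
  have hq : (extChartAt I p).symm (τ y) = (extChartAt I x).symm y := (extChartAt I p).left_inv hyp
  -- The tangent spaces at the two equal base points are both the model space, so the transport
  -- along `hq` is invisible on vectors of the model space.
  have hinner : ∀ (q q' : M) (_ : q = q') (u v : EuclideanSpace ℝ (Fin m)),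
      g.inner q u v = g.inner q' u v := by
    rintro q _ rfl u v
    rfl
  have hcoord : ∀ i, (show EuclideanSpace ℝ (Fin m) from coordVec I x y i) =
      ∑ k, D (EuclideanSpace.single i 1) k •
        (show EuclideanSpace ℝ (Fin m) from coordVec I p (τ y) k) := by
    intro i
    have h := mfderivWithin_extChartAt_symm_eq_comp x p hy hyp
      (EuclideanSpace.single i (1 : ℝ) : EuclideanSpace ℝ (Fin m))
    refine h.trans ?_
    have hsum : D (EuclideanSpace.single i 1) = ∑ k, D (EuclideanSpace.single i 1) k •
        (EuclideanSpace.single k 1 : EuclideanSpace ℝ (Fin m)) := by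
      simpa using
        ((EuclideanSpace.basisFun (Fin m) ℝ).sum_repr (D (EuclideanSpace.single i 1))).symm
    let T : EuclideanSpace ℝ (Fin m) →L[ℝ] EuclideanSpace ℝ (Fin m) :=
      mfderivWithin 𝓘(ℝ, EuclideanSpace ℝ (Fin m)) I (extChartAt I p).symm (Set.range I) (τ y)
    change T (D (EuclideanSpace.single i 1)) = ∑ k, _ • T (EuclideanSpace.single k 1)
    conv_lhs => rw [hsum]
    rw [map_sum]
    simp
  ext i j
  let B : EuclideanSpace ℝ (Fin m) →L[ℝ] EuclideanSpace ℝ (Fin m) →L[ℝ] ℝ :=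
    g.inner ((extChartAt I p).symm (τ y))
  have hentry : ∀ k i, LinearMap.toMatrix (EuclideanSpace.basisFun (Fin m) ℝ).toBasis
      (EuclideanSpace.basisFun (Fin m) ℝ).toBasis D.toLinearMap k i =
      D (EuclideanSpace.single i 1) k := by
    intro k i
    simp [LinearMap.toMatrix_apply]
  have hl : gramMatrix g x y i j = B (coordVec I x y i) (coordVec I x y j) :=
    (hinner _ _ hq _ _).symm
  rw [hl]
  refine (congrArg₂ (fun u v ↦ B u v) (hcoord i) (hcoord j)).trans ?_
  simp only [← hentry]
  exact bilin_sum_smul_eq_transpose_mul_mul B _ _ i j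

theorem sqrt_det_gramMatrix_eq_of_coord_change (g : Metric I M) (x p : M)
    {y : EuclideanSpace ℝ (Fin m)} (hy : y ∈ (extChartAt I x).target)
    (hyp : (extChartAt I x).symm y ∈ (extChartAt I p).source) :
    Real.sqrt (gramMatrix g x y).det =
      |(fderivWithin ℝ (extChartAt I p ∘ (extChartAt I x).symm) (Set.range I) y).det| *
        Real.sqrt (gramMatrix g p ((extChartAt I p ∘ (extChartAt I x).symm) y)).det := by
  rw [gramMatrix_eq_of_coord_change g x p hy hyp, Matrix.det_mul, Matrix.det_mul,
    Matrix.det_transpose, LinearMap.det_toMatrix, mul_right_comm, ← pow_two,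
    Real.sqrt_mul (sq_nonneg _), Real.sqrt_sq_eq_abs]

end Charts

/-! ### The Riemannian volume measure read in a chart -/

section Volume

variable {m : ℕ} {H : Type*} [TopologicalSpace H]
  {I : ModelWithCorners ℝ (EuclideanSpace ℝ (Fin m)) H}
  {M : Type*} [TopologicalSpace M] [ChartedSpace H M]

theorem measurableSet_extChartAt_target (x : M) : MeasurableSet (extChartAt I x).target := by
  rw [extChartAt_target]
  exact ((chartAt H x).open_target.preimage I.continuous_symm).measurableSet.inter
    I.isClosed_range.measurableSet

variable [MeasurableSpace M] [BorelSpace M]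

theorem measurableSet_target_inter_preimage_symm (x : M) {A : Set M} (hA : MeasurableSet A) :
    MeasurableSet ((extChartAt I x).target ∩ (extChartAt I x).symm ⁻¹' A) := by
  have h : Measurable ((extChartAt I x).target.domRestrict (extChartAt I x).symm) :=
    (continuousOn_iff_continuous_domRestrict.1 (continuousOn_extChartAt_symm x)).measurable
  have h' := (measurableSet_extChartAt_target (I := I) x).subtype_image (h hA)
  exact (Subtype.image_preimage_coe (extChartAt I x).target ((extChartAt I x).symm ⁻¹' A)) ▸ h'

variable [IsManifold I ∞ M]

theorem chartVolume_apply (g : Metric I M) (x : M) {A : Set M} (hA : MeasurableSet A) :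
    chartVolume g x A = ∫⁻ y in (extChartAt I x).target ∩ (extChartAt I x).symm ⁻¹' A,
      ENNReal.ofReal (Real.sqrt (gramMatrix g x y).det) := by
  have hT := measurableSet_extChartAt_target (I := I) x
  have hae : AEMeasurable (extChartAt I x).symm
      ((volume.restrict (extChartAt I x).target).withDensity
        fun y ↦ ENNReal.ofReal (Real.sqrt (gramMatrix g x y).det)) :=
    ((continuousOn_extChartAt_symm x).aemeasurable hT).mono_ac
      (withDensity_absolutelyContinuous _ _)
  have hs := measurableSet_target_inter_preimage_symm (I := I) x hA
  have hTc : ((volume.restrict (extChartAt I x).target).withDensity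
        fun y ↦ ENNReal.ofReal (Real.sqrt (gramMatrix g x y).det)) (extChartAt I x).targetᶜ = 0 :=
    withDensity_absolutelyContinuous _ _ (by
      rw [Measure.restrict_apply hT.compl, Set.compl_inter_self, measure_empty])
  rw [chartVolume, Measure.map_apply_of_aemeasurable hae hA,
    ← measure_inter_conull hTc, Set.inter_comm, withDensity_apply _ hs,
    Measure.restrict_restrict hs, Set.inter_right_comm, Set.inter_self]

/-- The volume measures of two charts agree on the intersection of the chart domains, by the change
of variables formula. Only the inequality that bounds a supremum over all charts is needed. -/
theorem chartVolume_apply_le (g : Metric I M) (x p : M) {A : Set M} (hA : MeasurableSet A)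
    (hAp : A ⊆ (extChartAt I p).source) : chartVolume g x A ≤ chartVolume g p A := by
  rw [chartVolume_apply g x hA, chartVolume_apply g p hA]
  set s := (extChartAt I x).target ∩ (extChartAt I x).symm ⁻¹' A with hs
  set τ := extChartAt I p ∘ (extChartAt I x).symm with hτ
  have hder : ∀ y ∈ s, HasFDerivWithinAt τ (fderivWithin ℝ τ (Set.range I) y) s y := fun y hy ↦
    ((contDiffWithinAt_ext_coord_change (n := ∞) p x ⟨hy.1, hAp hy.2⟩).differentiableWithinAt
      (by simp)).hasFDerivWithinAt.mono fun z hz ↦ extChartAt_target_subset_range x hz.1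
  have hinj : Set.InjOn τ s := by
    intro y hy z hz hyz
    exact (extChartAt I x).symm.injOn hy.1 hz.1
      ((extChartAt I p).injOn (hAp hy.2) (hAp hz.2) hyz)
  calc _ = ∫⁻ y in s, ENNReal.ofReal |(fderivWithin ℝ τ (Set.range I) y).det| *
          ENNReal.ofReal (Real.sqrt (gramMatrix g p (τ y)).det) := by
        refine setLIntegral_congr_fun (measurableSet_target_inter_preimage_symm x hA)
          fun y hy ↦ ?_
        rw [← ENNReal.ofReal_mul (abs_nonneg _)]
        exact congrArg ENNReal.ofReal
          (sqrt_det_gramMatrix_eq_of_coord_change g x p hy.1 (hAp hy.2))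
    _ = ∫⁻ z in τ '' s, ENNReal.ofReal (Real.sqrt (gramMatrix g p z).det) :=
        (lintegral_image_eq_lintegral_abs_det_fderiv_mul volume
          (measurableSet_target_inter_preimage_symm x hA) hder hinj
          fun z ↦ ENNReal.ofReal (Real.sqrt (gramMatrix g p z).det)).symm
    _ ≤ _ := by
        refine lintegral_mono_set ?_
        rintro _ ⟨y, hy, rfl⟩
        refine ⟨(extChartAt I p).map_source (hAp hy.2), ?_⟩
        rw [Set.mem_preimage, hτ, Function.comp_apply, (extChartAt I p).left_inv (hAp hy.2)]
        exact hy.2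

theorem volumeMeasure_restrict_source_le (g : Metric I M) (p : M) :
    (volumeMeasure g).restrict (extChartAt I p).source ≤ chartVolume g p := by
  have hS : MeasurableSet (extChartAt I p).source := (isOpen_extChartAt_source p).measurableSet
  -- Off the chart domain every measure is dominated by the largest one, `⊤`.
  have hle : volumeMeasure g ≤
      chartVolume g p + (⊤ : Measure M).restrict (extChartAt I p).sourceᶜ := by
    refine iSup_le fun x ↦ ?_
    rw [← Measure.restrict_add_restrict_compl (μ := chartVolume g x) hS]
    refine add_le_add (Measure.le_iff.2 fun A hA ↦ ?_) (Measure.restrict_mono le_rfl le_top)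
    rw [Measure.restrict_apply hA]
    exact (chartVolume_apply_le g x p (hA.inter hS) Set.inter_subset_right).trans
      (measure_mono Set.inter_subset_left)
  calc (volumeMeasure g).restrict (extChartAt I p).source
      ≤ (chartVolume g p + (⊤ : Measure M).restrict (extChartAt I p).sourceᶜ).restrict
          (extChartAt I p).source := Measure.restrict_mono le_rfl hle
    _ = (chartVolume g p).restrict (extChartAt I p).source := by
        rw [Measure.restrict_add, Measure.restrict_restrict hS, Set.inter_compl_self,
          Measure.restrict_empty, add_zero]
    _ ≤ chartVolume g p := Measure.restrict_le_self

/-- An integral for the Riemannian volume over a subset of a chart domain is bounded by a Lebesgue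
integral in coordinates, at the cost of a bound for the volume density. -/
theorem setLIntegral_volumeMeasure_le (g : Metric I M) (p : M) {K : Set M} (hK : MeasurableSet K)
    (hKp : K ⊆ (extChartAt I p).source) {D : ℝ}
    (hD : ∀ y ∈ (extChartAt I p).target, (extChartAt I p).symm y ∈ K →
      Real.sqrt (gramMatrix g p y).det ≤ D)
    (F : M → ℝ≥0∞) (h : EuclideanSpace ℝ (Fin m) → ℝ≥0∞)
    (hF : ∀ q ∈ K, F q ≤ h (extChartAt I p q)) :
    ∫⁻ q in K, F q ∂(volumeMeasure g) ≤ ENNReal.ofReal D * ∫⁻ y, h y := by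
  have hT := measurableSet_extChartAt_target (I := I) p
  have hmeas : (volumeMeasure g).restrict K ≤
      ENNReal.ofReal D • Measure.map (extChartAt I p).symm
        (volume.restrict (extChartAt I p).target) := by
    refine Measure.le_iff.2 fun A hA ↦ ?_
    have hAK := hA.inter hK
    rw [Measure.smul_apply, Measure.map_apply_of_aemeasurable
      ((continuousOn_extChartAt_symm p).aemeasurable hT) hA, Measure.restrict_apply' hT,
      smul_eq_mul,
      Set.inter_comm _ (extChartAt I p).target, Measure.restrict_apply hA]
    calc volumeMeasure g (A ∩ K) = (volumeMeasure g).restrict (extChartAt I p).source (A ∩ K) := by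
          rw [Measure.restrict_apply hAK, Set.inter_assoc, Set.inter_eq_left.2 hKp]
      _ ≤ chartVolume g p (A ∩ K) := volumeMeasure_restrict_source_le g p _
      _ ≤ ∫⁻ _y in (extChartAt I p).target ∩ (extChartAt I p).symm ⁻¹' (A ∩ K),
            ENNReal.ofReal D := by
          rw [chartVolume_apply g p hAK]
          exact setLIntegral_mono' (measurableSet_target_inter_preimage_symm p hAK)
            fun y hy ↦ ENNReal.ofReal_le_ofReal (hD y hy.1 hy.2.2)
      _ ≤ _ := by
          rw [setLIntegral_const]
          gcongr
          exact Set.inter_subset_left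
  calc ∫⁻ q in K, F q ∂(volumeMeasure g)
      ≤ ∫⁻ q in K, h (extChartAt I p q) ∂(volumeMeasure g) := setLIntegral_mono' hK hF
    _ ≤ ENNReal.ofReal D * ∫⁻ q, h (extChartAt I p q)
          ∂(Measure.map (extChartAt I p).symm (volume.restrict (extChartAt I p).target)) := by
        refine (lintegral_mono' hmeas le_rfl).trans ?_
        rw [lintegral_smul_measure, smul_eq_mul]
    _ ≤ ENNReal.ofReal D * ∫⁻ y in (extChartAt I p).target,
          h (extChartAt I p ((extChartAt I p).symm y)) := by
        gcongr
        exact lintegral_map_le _ _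
    _ = ENNReal.ofReal D * ∫⁻ y in (extChartAt I p).target, h y := by
        congr 1
        exact setLIntegral_congr_fun hT fun y hy ↦ by rw [(extChartAt I p).right_inv hy]
    _ ≤ _ := by
        gcongr
        exact Measure.restrict_le_self

end Volume

/-! ### Functions supported in a chart and their Dirichlet energy -/

section Lift

variable {m : ℕ} {H : Type*} [TopologicalSpace H]
  {I : ModelWithCorners ℝ (EuclideanSpace ℝ (Fin m)) H}
  {M : Type*} [TopologicalSpace M] [ChartedSpace H M]

/-- The function on `M` that reads `f` in the chart at `p`, cut off by `χ` to vanish outside the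
domain of that chart. -/
noncomputable def chartLift {p : M} (χ : SmoothBumpFunction I p)
    (f : EuclideanSpace ℝ (Fin m) → ℝ) (q : M) : ℝ :=
  χ q * f (extChartAt I p q)

theorem chartLift_eq {p : M} (χ : SmoothBumpFunction I p) (f : EuclideanSpace ℝ (Fin m) → ℝ)
    {q : M} (hq : q ∈ (extChartAt I p).source)
    (hd : dist (extChartAt I p q) (extChartAt I p p) ≤ χ.rIn) :
    chartLift χ f q = f (extChartAt I p q) := by
  rw [chartLift, χ.one_of_dist_le (by simpa using hq) hd, one_mul]

variable [T2Space M] [IsManifold I ∞ M]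

theorem contMDiff_chartLift {p : M} (χ : SmoothBumpFunction I p)
    {f : EuclideanSpace ℝ (Fin m) → ℝ} (hf : ContDiff ℝ ∞ f) :
    ContMDiff I 𝓘(ℝ, ℝ) ∞ (chartLift χ f) :=
  χ.contMDiff_smul (hf.contMDiff.comp_contMDiffOn contMDiffOn_extChartAt)

/-- For functions supported close to the centre of a chart, the Dirichlet energy is bounded by a
constant times the Euclidean Dirichlet energy in coordinates. -/
theorem exists_dirichletEnergy_chartLift_le [MeasurableSpace M] [BorelSpace M] (g : Metric I M)
    {p : M} (χ : SmoothBumpFunction I p) :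
    ∃ (ρ : ℝ) (C : ℝ≥0∞), 0 < ρ ∧ ρ < χ.rIn ∧ C ≠ ⊤ ∧ ∀ f : EuclideanSpace ℝ (Fin m) → ℝ,
      ContDiff ℝ ∞ f → (∀ y ∉ Metric.closedBall (extChartAt I p p) ρ, f y = 0) →
      dirichletEnergy g (chartLift χ f) ≤ C * ∫⁻ y, ‖fderiv ℝ f y‖ₑ ^ 2 := by
  obtain ⟨C, hC, hCp⟩ := exists_eventually_norm_mfderiv_extChartAt_le g p
  obtain ⟨D, hDp⟩ := exists_eventually_sqrt_det_gramMatrix_le g p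
  have hCp' : ∀ᶠ y in 𝓝[Set.range I] (extChartAt I p p),
      ∀ v : TangentSpace I ((extChartAt I p).symm y), g.inner _ v v ≤ 1 →
        ‖(show EuclideanSpace ℝ (Fin m) from
          mfderiv I 𝓘(ℝ, EuclideanSpace ℝ (Fin m)) (extChartAt I p)
            ((extChartAt I p).symm y) v)‖ ≤ C := by
    have h := (continuousAt_extChartAt_symm (I := I) p).tendsto
    rw [extChartAt_to_inv] at h
    exact (h.eventually hCp).filter_mono nhdsWithin_le_nhds
  obtain ⟨ε, hε, hεb⟩ := Metric.mem_nhdsWithin_iff.1 (hCp'.and hDp)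
  set y₀ := extChartAt I p p with hy₀
  -- Up to radius `ε` the metric bounds hold; below `χ.rIn` the cut-off `χ` equals `1`.
  set ρ := min ε χ.rIn / 2
  have hmin : 0 < min ε χ.rIn := lt_min hε χ.rIn_pos
  have hρ0 : 0 < ρ := half_pos hmin
  have hρε : ρ < ε := (half_lt_self hmin).trans_le (min_le_left _ _)
  have hρχ : ρ < χ.rIn := (half_lt_self hmin).trans_le (min_le_right _ _)
  refine ⟨ρ, ENNReal.ofReal D * ENNReal.ofReal C ^ 2, hρ0, hρχ, by finiteness, fun f hf hf0 ↦ ?_⟩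
  set K := (extChartAt I p).symm '' (Metric.closedBall y₀ ρ ∩ Set.range I) with hKdef
  have hsub : Metric.closedBall y₀ ρ ∩ Set.range I ⊆ (extChartAt I p).target :=
    (Set.inter_subset_inter_left _ (Metric.closedBall_subset_closedBall
      (hρχ.le.trans χ.rIn_lt_rOut.le))).trans χ.closedBall_subset
  have hKclosed : IsClosed K := by
    refine (IsCompact.image_of_continuousOn ?_
      ((continuousOn_extChartAt_symm p).mono hsub)).isClosed
    exact (isCompact_closedBall _ _).inter_right I.isClosed_range
  have hKsrc : K ⊆ (extChartAt I p).source := by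
    rintro _ ⟨y, hy, rfl⟩
    exact (extChartAt I p).map_target (hsub hy)
  have hKball : ∀ q ∈ K, extChartAt I p q ∈ Metric.closedBall y₀ ρ ∩ Set.range I := by
    rintro _ ⟨y, hy, rfl⟩
    rwa [(extChartAt I p).right_inv (hsub hy)]
  have hgood : ∀ y ∈ Metric.closedBall y₀ ρ ∩ Set.range I, _ := fun y hy ↦
    hεb ⟨Metric.closedBall_subset_ball hρε hy.1, hy.2⟩
  have hoff : ∀ q ∉ K, chartLift χ f q = 0 := by
    intro q hq
    by_cases hqs : q ∈ (extChartAt I p).source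
    · rw [chartLift, hf0, mul_zero]
      intro hqb
      exact hq ⟨_, ⟨hqb, extChartAt_target_subset_range p ((extChartAt I p).map_source hqs)⟩,
        (extChartAt I p).left_inv hqs⟩
    · rw [chartLift, show χ q = 0 from Function.notMem_support.1 fun h ↦ hqs (by
        simpa using χ.support_subset_source h), zero_mul]
  have hzero : ∀ q ∉ K, normSqDifferential g (chartLift χ f) q = 0 := by
    intro q hq
    have h : chartLift χ f =ᶠ[𝓝 q] fun _ ↦ 0 :=
      Filter.mem_of_superset (hKclosed.isOpen_compl.mem_nhds hq) hoff
    have h0 : mfderiv I 𝓘(ℝ, ℝ) (chartLift χ f) q = 0 := h.mfderiv_eq.trans mfderiv_const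
    refine le_antisymm (iSup₂_le fun v _ ↦ ?_) bot_le
    rw [h0]
    exact (ENNReal.ofReal_eq_zero.2 (zero_pow two_ne_zero).le).le
  have hin : ∀ q ∈ K, normSqDifferential g (chartLift χ f) q ≤
      ENNReal.ofReal C ^ 2 * ‖fderiv ℝ f (extChartAt I p q)‖ₑ ^ 2 := by
    intro q hq
    have hqs := hKsrc hq
    have hqs' : q ∈ (chartAt H p).source := by simpa using hqs
    have hev : chartLift χ f =ᶠ[𝓝 q] f ∘ extChartAt I p := by
      filter_upwards [χ.eventuallyEq_one_of_dist_lt hqs' ((hKball q hq).1.trans_lt hρχ)] with z hz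
      rw [chartLift, hz]
      simp
    have hmf : mfderiv I 𝓘(ℝ, ℝ) (chartLift χ f) q =
        (mfderiv 𝓘(ℝ, EuclideanSpace ℝ (Fin m)) 𝓘(ℝ, ℝ) f (extChartAt I p q)).comp
          (mfderiv I 𝓘(ℝ, EuclideanSpace ℝ (Fin m)) (extChartAt I p) q) :=
      hev.mfderiv_eq.trans (mfderiv_comp q
        (hf.differentiable (by simp)).differentiableAt.mdifferentiableAt
        (mdifferentiableAt_extChartAt hqs'))
    refine iSup₂_le fun v hv ↦ ?_
    have hb : ‖(show EuclideanSpace ℝ (Fin m) from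
        mfderiv I 𝓘(ℝ, EuclideanSpace ℝ (Fin m)) (extChartAt I p) q v)‖ ≤ C := by
      have h := (hgood _ (hKball q hq)).1
      rw [(extChartAt I p).left_inv hqs] at h
      exact h v hv
    have hval : (show ℝ from mfderiv I 𝓘(ℝ, ℝ) (chartLift χ f) q v) =
        fderiv ℝ f (extChartAt I p q) (mfderiv I 𝓘(ℝ, EuclideanSpace ℝ (Fin m))
          (extChartAt I p) q v) := by
      rw [mfderiv_eq_fderiv] at hmf
      exact congrArg (fun L : EuclideanSpace ℝ (Fin m) →L[ℝ] ℝ ↦ L v) hmf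
    rw [hval, ← ofReal_norm, ← ENNReal.ofReal_pow hC.le, ← ENNReal.ofReal_pow (norm_nonneg _),
      ← ENNReal.ofReal_mul (by positivity), ← mul_pow]
    refine ENNReal.ofReal_le_ofReal (sq_le_sq' ?_ ?_)
    all_goals
      have h := ((fderiv ℝ f (extChartAt I p q)).le_opNorm _).trans
        (mul_le_mul_of_nonneg_left hb (norm_nonneg _))
      rw [mul_comm, Real.norm_eq_abs] at h
      have h' := abs_le.1 h
    · exact h'.1
    · exact h'.2
  calc dirichletEnergy g (chartLift χ f)
      = ∫⁻ q in K, normSqDifferential g (chartLift χ f) q ∂(volumeMeasure g) := by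
        rw [dirichletEnergy, ← lintegral_indicator hKclosed.measurableSet]
        refine lintegral_congr fun q ↦ ?_
        by_cases hq : q ∈ K
        · rw [Set.indicator_of_mem hq]
        · rw [Set.indicator_of_notMem hq, hzero q hq]
    _ ≤ ENNReal.ofReal D * ∫⁻ y, ENNReal.ofReal C ^ 2 * ‖fderiv ℝ f y‖ₑ ^ 2 := by
        refine setLIntegral_volumeMeasure_le g p hKclosed.measurableSet hKsrc (fun y hy hyK ↦ ?_)
          _ _ hin
        have h := hKball _ hyK
        rw [(extChartAt I p).right_inv hy] at h
        exact (hgood y h).2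
    _ = _ := by rw [lintegral_const_mul' _ _ (by finiteness), mul_assoc]

end Lift

/-! ### Eigenvalue bounds from functions with disjoint supports -/

section Variational

variable {m : ℕ} {H : Type*} [TopologicalSpace H]
  {I : ModelWithCorners ℝ (EuclideanSpace ℝ (Fin m)) H}
  {M : Type*} [TopologicalSpace M] [ChartedSpace H M] [IsManifold I ∞ M]
  [MeasurableSpace M] [BorelSpace M]

theorem sum_sq_mul_le_massSq {ι : Type*} [Fintype ι] (μ : Measure M) (φ : ι → M → ℝ)
    (hcont : ∀ j, Continuous (φ j)) (hdisj : ∀ i j, i ≠ j → ∀ q, φ i q * φ j q = 0) {a : ℝ≥0∞}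
    (ha : ∀ j, a ≤ massSq μ (φ j)) (b : ι → ℝ) :
    (∑ j, ENNReal.ofReal (b j ^ 2)) * a ≤ massSq μ fun q ↦ ∑ j, b j * φ j q := by
  have hpt : ∀ q, ENNReal.ofReal ((∑ j, b j * φ j q) ^ 2) =
      ∑ j, ENNReal.ofReal (b j ^ 2) * ENNReal.ofReal (φ j q ^ 2) := by
    intro q
    have h : (∑ j, b j * φ j q) ^ 2 = ∑ j, b j ^ 2 * φ j q ^ 2 := by
      rw [pow_two, Finset.sum_mul_sum]
      refine Finset.sum_congr rfl fun i _ ↦ ?_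
      rw [Finset.sum_eq_single i]
      · ring
      · intro j _ hji
        linear_combination b i * b j * hdisj i j hji.symm q
      · simp
    rw [h, ENNReal.ofReal_sum_of_nonneg fun j _ ↦ by positivity]
    exact Finset.sum_congr rfl fun j _ ↦ ENNReal.ofReal_mul (sq_nonneg _)
  calc (∑ j, ENNReal.ofReal (b j ^ 2)) * a
      ≤ ∑ j, ENNReal.ofReal (b j ^ 2) * massSq μ (φ j) := by
        rw [Finset.sum_mul]
        exact Finset.sum_le_sum fun j _ ↦ by gcongr; exact ha j
    _ = ∫⁻ q, ∑ j, ENNReal.ofReal (b j ^ 2) * ENNReal.ofReal (φ j q ^ 2) ∂μ := by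
        rw [lintegral_finsetSum]
        · refine Finset.sum_congr rfl fun j _ ↦ ?_
          rw [massSq, lintegral_const_mul' _ _ ENNReal.ofReal_ne_top]
        · intro j _
          exact (((hcont j).pow 2).measurable.ennreal_ofReal).const_mul _
    _ = _ := by simp only [massSq, hpt]

/-- Test functions with disjoint supports span a `(k + 1)`-dimensional space on which their common
Rayleigh bound holds. -/
theorem eigenvalue_le_div (g : Metric I M) (k : ℕ) (μ : Measure M)
    (φ : Fin (k + 1) → C^∞⟮I, M; 𝓘(ℝ, ℝ), ℝ⟯)
    (hdisj : ∀ i j, i ≠ j → ∀ q, φ i q * φ j q = 0) {a e : ℝ≥0∞} (ha0 : a ≠ 0)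
    (ha : ∀ j, a ≤ massSq μ (φ j))
    (he : ∀ b : Fin (k + 1) → ℝ, dirichletEnergy g (fun q ↦ ∑ j, b j * φ j q) ≤
      (∑ j, ENNReal.ofReal (b j ^ 2)) * e) :
    eigenvalue g k μ ≤ e / a := by
  have hmass := sum_sq_mul_le_massSq μ (fun j ↦ φ j) (fun j ↦ (φ j).contMDiff.continuous) hdisj ha
  have hcoe : ∀ b : Fin (k + 1) → ℝ, ⇑(∑ j, b j • φ j) = fun q ↦ ∑ j, b j * φ j q := by
    intro b
    ext q
    have h := map_sum (ContMDiffMap.coeFnAddMonoidHom (I := I) (I' := 𝓘(ℝ, ℝ)) (N := M) (G := ℝ)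
      (n := ∞)) (fun j ↦ b j • φ j) Finset.univ
    have h' := congrFun h q
    simpa [Finset.sum_apply] using h'
  have hpos : ∀ b : Fin (k + 1) → ℝ, b ≠ 0 → ∑ j, ENNReal.ofReal (b j ^ 2) ≠ 0 := by
    intro b hb h
    refine hb (funext fun j ↦ ?_)
    have := (Finset.sum_eq_zero_iff.1 h) j (Finset.mem_univ j)
    rw [ENNReal.ofReal_eq_zero] at this
    exact pow_eq_zero_iff two_ne_zero |>.1 (le_antisymm this (sq_nonneg _))
  have hli : LinearIndependent ℝ φ := by
    rw [Fintype.linearIndependent_iff]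
    intro b hb
    by_contra! hne
    obtain ⟨i, hi⟩ := hne
    have h := hmass b
    rw [← hcoe b, hb] at h
    have h0 : massSq μ (⇑(0 : C^∞⟮I, M; 𝓘(ℝ, ℝ), ℝ⟯)) = 0 := by simp [massSq]
    rw [h0, nonpos_iff_eq_zero, mul_eq_zero] at h
    exact h.elim (hpos b fun hb0 ↦ hi (congrFun hb0 i)) ha0
  refine (iInf₂_le (Submodule.span ℝ (Set.range φ)) (by
    rw [finrank_span_eq_card hli, Fintype.card_fin])).trans ?_
  refine iSup_le fun ψ ↦ iSup₂_le fun hψ hψ0 ↦ ?_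
  obtain ⟨b, rfl⟩ := (Submodule.mem_span_range_iff_exists_fun ℝ).1 hψ
  have hb : b ≠ 0 := by
    rintro rfl
    exact hψ0 (by simp)
  have hS0 := hpos b hb
  have hStop : ∑ j, ENNReal.ofReal (b j ^ 2) ≠ ⊤ :=
    ENNReal.sum_ne_top.2 fun j _ ↦ ENNReal.ofReal_ne_top
  have hm : (∑ j, ENNReal.ofReal (b j ^ 2)) * a ≤ massSq μ (⇑(∑ j, b j • φ j)) := by
    rw [hcoe b]; exact hmass b
  have hd : dirichletEnergy g (⇑(∑ j, b j • φ j)) ≤ (∑ j, ENNReal.ofReal (b j ^ 2)) * e := by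
    rw [hcoe b]; exact he b
  rw [rayleigh, if_neg fun h ↦ mul_ne_zero hS0 ha0 (le_antisymm (hm.trans h.le) bot_le),
    ← ENNReal.mul_div_mul_left e a hS0 hStop]
  exact ENNReal.div_le_div hd hm

end Variational

section EuclideanSum

variable {E : Type*} [NormedAddCommGroup E] [NormedSpace ℝ E] [MeasurableSpace E] [BorelSpace E]

/-- The energy of a linear combination, by the Cauchy–Schwarz inequality; disjointness of supports
would remove the factor `Fintype.card ι`. -/
theorem lintegral_enorm_fderiv_sum_sq_le {ι : Type*} [Fintype ι] (vol : Measure E)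
    (f : ι → E → ℝ) (hf : ∀ j, ContDiff ℝ ∞ (f j)) {e : ℝ≥0∞}
    (he : ∀ j, ∫⁻ y, ‖fderiv ℝ (f j) y‖ₑ ^ 2 ∂vol ≤ e) (b : ι → ℝ) :
    ∫⁻ y, ‖fderiv ℝ (fun y ↦ ∑ j, b j * f j y) y‖ₑ ^ 2 ∂vol ≤
      (∑ j, ENNReal.ofReal (b j ^ 2)) * (Fintype.card ι * e) := by
  have hpt : ∀ y, ‖fderiv ℝ (fun y ↦ ∑ j, b j * f j y) y‖ₑ ^ 2 ≤
      Fintype.card ι * ∑ j, ENNReal.ofReal (b j ^ 2) * ‖fderiv ℝ (f j) y‖ₑ ^ 2 := by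
    intro y
    have hder : HasFDerivAt (fun y ↦ ∑ j, b j * f j y) (∑ j, b j • fderiv ℝ (f j) y) y :=
      HasFDerivAt.fun_sum fun j _ ↦
        (((hf j).differentiable (by simp) y).hasFDerivAt).const_mul (b j)
    rw [hder.fderiv]
    have h1 : ‖∑ j, b j • fderiv ℝ (f j) y‖ₑ ≤ ∑ j, ‖b j • fderiv ℝ (f j) y‖ₑ := by
      simp only [← ofReal_norm]
      rw [← ENNReal.ofReal_sum_of_nonneg fun j _ ↦ norm_nonneg _]
      exact ENNReal.ofReal_le_ofReal (norm_sum_le _ _)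
    have h2 := ENNReal.rpow_sum_le_const_mul_sum_rpow (p := 2) Finset.univ
      (fun j ↦ ‖b j • fderiv ℝ (f j) y‖ₑ) one_le_two
    simp only [ENNReal.rpow_two] at h2
    rw [show (2 : ℝ) - 1 = 1 by norm_num, ENNReal.rpow_one, Finset.card_univ] at h2
    refine (pow_le_pow_left₀ bot_le h1 2).trans (h2.trans_eq ?_)
    congr 1
    refine Finset.sum_congr rfl fun j _ ↦ ?_
    rw [enorm_smul, mul_pow, Real.enorm_eq_ofReal_abs, ← ENNReal.ofReal_pow (abs_nonneg _), sq_abs]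
  calc _ ≤ ∫⁻ y, Fintype.card ι * ∑ j, ENNReal.ofReal (b j ^ 2) * ‖fderiv ℝ (f j) y‖ₑ ^ 2 ∂vol :=
        lintegral_mono hpt
    _ = Fintype.card ι * ∑ j, ENNReal.ofReal (b j ^ 2) * ∫⁻ y, ‖fderiv ℝ (f j) y‖ₑ ^ 2 ∂vol := by
        rw [lintegral_const_mul' _ _ (by finiteness), lintegral_finsetSum]
        · congr 1
          exact Finset.sum_congr rfl fun j _ ↦ lintegral_const_mul' _ _ ENNReal.ofReal_ne_top
        · intro j _
          exact (((ENNReal.continuous_pow 2).comp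
            ((hf j).continuous_fderiv (by simp)).enorm).measurable).const_mul _
    _ ≤ Fintype.card ι * ∑ j, ENNReal.ofReal (b j ^ 2) * e := by
        gcongr with j
        exact he j
    _ = _ := by rw [← Finset.sum_mul]; ring

end EuclideanSum

/-! ### Concentration of measure at a point -/

/-- An atom of a weak limit forces mass into every neighbourhood of it. -/
theorem eventually_lt_measure_of_tendsto {X : Type*} [TopologicalSpace X] [T2Space X]
    [CompactSpace X] [MeasurableSpace X] [BorelSpace X] {μs : ℕ → FiniteMeasure X}
    {μ : FiniteMeasure X} (hlim : Tendsto μs atTop (𝓝 μ)) {p : X} {U : Set X} (hU : IsOpen U)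
    (hpU : p ∈ U) {b : ℝ≥0∞} (hb : b < (μ : Measure X) {p}) :
    ∀ᶠ n in atTop, b < (μs n : Measure X) U := by
  obtain ⟨f, hf0, hf1, hf⟩ := exists_continuous_zero_one_of_isClosed hU.isClosed_compl
    (isClosed_singleton (x := p)) (by simpa using hpU)
  let F : BoundedContinuousFunction X NNReal := BoundedContinuousFunction.mkOfCompact
    ⟨fun x ↦ (f x).toNNReal, continuous_real_toNNReal.comp f.continuous⟩
  have hFp : F p = 1 := by
    change (f p).toNNReal = 1
    rw [hf1 rfl]; simp
  have hF : ∀ x, (F x : ℝ≥0∞) ≤ U.indicator 1 x := by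
    intro x
    change ((f x).toNNReal : ℝ≥0∞) ≤ _
    by_cases hx : x ∈ U
    · rw [Set.indicator_of_mem hx]
      simpa using (hf x).2
    · rw [hf0 hx]; simp
  have hlow : (μ : Measure X) {p} ≤ ∫⁻ x, F x ∂(μ : Measure X) := by
    calc (μ : Measure X) {p} = ∫⁻ x in {p}, F x ∂(μ : Measure X) := by
          rw [lintegral_singleton, hFp]; simp
      _ ≤ _ := setLIntegral_le_lintegral _ _
  have h := FiniteMeasure.tendsto_iff_forall_lintegral_tendsto.1 hlim F
  filter_upwards [h.eventually_const_lt (hb.trans_le hlow)] with n hn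
  refine hn.trans_le ((lintegral_mono hF).trans_eq ?_)
  rw [lintegral_indicator_one hU.measurableSet]

section Concentration

variable {m : ℕ} {H : Type*} [TopologicalSpace H]
  {I : ModelWithCorners ℝ (EuclideanSpace ℝ (Fin m)) H}
  {M : Type*} [TopologicalSpace M] [T2Space M] [ChartedSpace H M] [IsManifold I ∞ M]
  [MeasurableSpace M] [BorelSpace M]

/-- Every measure without atoms that puts mass at least `δ` in the coordinate ball of radius `R`
around `p` has `λ_k = O(R ^ (m - 2))`, with a constant independent of the measure. -/
theorem exists_eigenvalue_le_of_concentrated (hm : 2 ≤ m) (g : Metric I M) (k : ℕ) (p : M)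
    {δ : ℝ≥0∞} (hδ : δ ≠ 0) :
    ∃ (ρ : ℝ) (L : ℝ≥0∞), 0 < ρ ∧ L ≠ ⊤ ∧ ∀ (R : ℝ) (μ : Measure M) [IsFiniteMeasure μ], 0 < R →
      R ≤ ρ → (∀ q, μ {q} = 0) →
      δ ≤ μ ((extChartAt I p).source ∩ extChartAt I p ⁻¹' Metric.ball (extChartAt I p p) R) →
      eigenvalue g k μ ≤ L * ENNReal.ofReal (R ^ (m - 2)) := by
  obtain ⟨χ⟩ : Nonempty (SmoothBumpFunction I p) := inferInstance
  obtain ⟨ρ, C, hρ, hρχ, hC, henergy⟩ := exists_dirichletEnergy_chartLift_le g χ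
  obtain ⟨A, K, hK, hsep⟩ := exists_separated_functions
    (volume : Measure (EuclideanSpace ℝ (Fin m))) (by simpa using hm) (k + 1)
  rw [finrank_euclideanSpace_fin] at hsep
  -- `A` may be `0`, so `δ / A` could be infinite.
  set a : ℝ≥0∞ := δ / (A + 1) with ha
  have ha0 : a ≠ 0 := (ENNReal.div_pos hδ (by finiteness)).ne'
  have hAa : A * a ≤ δ := by
    calc (A : ℝ≥0∞) * a ≤ (A + 1) * a := by gcongr; exact le_self_add
      _ = δ := ENNReal.mul_div_cancel (by simp) (by finiteness)
  refine ⟨ρ / 4, C * (((k + 1 : ℕ) : ℝ≥0∞) * K) / a, by positivity,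
    ENNReal.div_ne_top (by finiteness) ha0, fun R μ _ hR hRρ hatom hmass ↦ ?_⟩
  set U := (extChartAt I p).source ∩ extChartAt I p ⁻¹' Metric.ball (extChartAt I p p) R with hU
  have hUm : MeasurableSet U := (isOpen_extChartAt_preimage' p Metric.isOpen_ball).measurableSet
  have hae : AEMeasurable (extChartAt I p) (μ.restrict U) :=
    ((continuousOn_extChartAt p).mono Set.inter_subset_left).aemeasurable hUm
  have hball : MeasurableSet (Metric.ball (extChartAt I p p) R)ᶜ :=
    Metric.isOpen_ball.measurableSet.compl
  obtain ⟨f, hf, -, hf0, hfd, hfm, hfe⟩ := hsep (Measure.map (extChartAt I p) (μ.restrict U))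
    (extChartAt I p p) R a hR
    (fun y ↦ by
      rw [Measure.map_apply_of_aemeasurable hae (measurableSet_singleton y),
        Measure.restrict_apply' hUm]
      refine measure_mono_null ?_ (hatom ((extChartAt I p).symm y))
      rintro q ⟨hq, hqU⟩
      rw [Set.mem_preimage, Set.mem_singleton_iff] at hq
      rw [Set.mem_singleton_iff, ← hq, (extChartAt I p).left_inv hqU.1])
    (by
      rw [Measure.map_apply_of_aemeasurable hae hball, Measure.restrict_apply' hUm]
      refine measure_mono_null ?_ measure_empty
      rintro q ⟨hq, hqU⟩
      exact hq hqU.2)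
    (pos_iff_ne_zero.2 ha0)
    (by
      rw [Measure.map_apply_of_aemeasurable hae MeasurableSet.univ, Set.preimage_univ,
        Measure.restrict_apply_univ]
      exact hAa.trans hmass)
  have hf0' : ∀ j, ∀ y ∉ Metric.closedBall (extChartAt I p p) ρ, f j y = 0 := fun j y hy ↦
    hf0 j y fun h ↦ hy (Metric.closedBall_subset_closedBall (by linarith) h)
  have hbound := eigenvalue_le_div g k μ (fun j ↦ ⟨chartLift χ (f j), contMDiff_chartLift χ (hf j)⟩)
    (fun i j hij q ↦ by
      change χ q * f i _ * (χ q * f j _) = 0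
      linear_combination χ q ^ 2 * hfd i j hij (extChartAt I p q))
    (e := C * (((k + 1 : ℕ) : ℝ≥0∞) * (K * ENNReal.ofReal (R ^ (m - 2))))) ha0
    (fun j ↦ by
      refine (hfm j).trans ((lintegral_map_le _ _).trans ?_)
      refine (setLIntegral_mono' hUm fun q hq ↦ ?_).trans (setLIntegral_le_lintegral U _)
      have hd : dist (extChartAt I p q) (extChartAt I p p) ≤ χ.rIn := by
        have := Metric.mem_ball.1 hq.2
        linarith
      exact (congrArg (fun t : ℝ ↦ ENNReal.ofReal (t ^ 2)) (chartLift_eq χ (f j) hq.1 hd)).ge)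
    (fun b ↦ by
      have hsum : (fun q ↦ ∑ j, b j * chartLift χ (f j) q) =
          chartLift χ fun y ↦ ∑ j, b j * f j y := by
        ext q
        simp only [chartLift, Finset.mul_sum]
        exact Finset.sum_congr rfl fun j _ ↦ by ring
      change dirichletEnergy g (fun q ↦ ∑ j, b j * chartLift χ (f j) q) ≤ _
      rw [hsum]
      refine (henergy _ (ContDiff.sum fun j _ ↦ contDiff_const.mul (hf j)) fun y hy ↦
        Finset.sum_eq_zero fun j _ ↦ by rw [hf0' j y hy, mul_zero]).trans ?_
      have h := lintegral_enorm_fderiv_sum_sq_le volume f hf hfe b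
      rw [Fintype.card_fin] at h
      exact (mul_le_mul_right h C).trans_eq (by ring))
  refine hbound.trans_eq ?_
  simp only [div_eq_mul_inv]
  ring

end Concentration


end MeasureEigenvalue

theorem mainTheorem8 {m : ℕ} (hm : 3 ≤ m)
    {H : Type*} [TopologicalSpace H] (I : ModelWithCorners ℝ (EuclideanSpace ℝ (Fin m)) H)
    {M : Type*} [TopologicalSpace M] [T2Space M] [CompactSpace M]
    [ChartedSpace H M] [IsManifold I ∞ M] [MeasurableSpace M] [BorelSpace M]
    (g : MeasureEigenvalue.Metric I M) (k : ℕ)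
    (μs : ℕ → FiniteMeasure M) (μ : FiniteMeasure M)
    (hμs : ∀ n, ∀ p : M, (μs n : Measure M) {p} = 0)
    (hlim : Tendsto μs atTop (𝓝 μ))
    (c : ℝ) (hc : 0 < c)
    (hbound : ∀ n, ENNReal.ofReal c ≤ MeasureEigenvalue.eigenvalue g k (μs n : Measure M)) :
    ∀ p : M, (μ : Measure M) {p} = 0 := by
  intro p
  by_contra hp
  have hhalf : (μ : Measure M) {p} / 2 < (μ : Measure M) {p} :=
    ENNReal.half_lt_self hp (measure_ne_top _ _)
  obtain ⟨ρ, L, hρ, hL, hle⟩ := MeasureEigenvalue.exists_eigenvalue_le_of_concentrated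
    (by omega : 2 ≤ m) g k p (ENNReal.half_pos hp).ne'
  have hsmall : ∀ R : ℝ, 0 < R → R ≤ ρ → ENNReal.ofReal c ≤ L * ENNReal.ofReal (R ^ (m - 2)) := by
    intro R hR hRρ
    obtain ⟨n, hn⟩ := (MeasureEigenvalue.eventually_lt_measure_of_tendsto hlim
      (isOpen_extChartAt_preimage' (I := I) p (Metric.isOpen_ball (ε := R)))
      ⟨mem_extChartAt_source p, Metric.mem_ball_self hR⟩ hhalf).exists
    exact (hbound n).trans (hle R _ hR hRρ (hμs n) hn.le)
  have hpow : Tendsto (fun R : ℝ ↦ R ^ (m - 2)) (𝓝[>] 0) (𝓝 0) := by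
    have h := (continuous_pow (M := ℝ) (m - 2)).tendsto 0
    rw [zero_pow (by omega)] at h
    exact h.mono_left nhdsWithin_le_nhds
  have hlimit : Tendsto (fun R : ℝ ↦ L * ENNReal.ofReal (R ^ (m - 2))) (𝓝[>] 0) (𝓝 0) := by
    simpa using ENNReal.Tendsto.const_mul (ENNReal.tendsto_ofReal hpow) (Or.inr hL)
  have hev : ∀ᶠ R : ℝ in 𝓝[>] 0, ENNReal.ofReal c ≤ L * ENNReal.ofReal (R ^ (m - 2)) := by
    filter_upwards [Ioc_mem_nhdsGT hρ] with R hR using hsmall R hR.1 hR.2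
  exact (ENNReal.ofReal_pos.2 hc).not_ge (ge_of_tendsto hlimit hev)
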